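/- Let $H$ be an infinite-dimensional separable real Hilbert space. Then there exists a continuous (hence Fréchet differentiable), strictly convex quadratic form $F:H\to[0,\infty)$ with $F(u)=0$ if and only if $u=0$, such that the following is true for every $\alpha>0$: for every monotone decreasing function $g:(0,\infty)\to(0,\infty)$ such that \[ \int_0^\infty t\,g(t)\,\mathrm{d}t<\infty, \] there exists a solution $u$ to the heavy-ball ODE \[ \ddot u(t) = -\frac{\alpha}{t}\,\dot u(t) - \nabla F(u(t)),\qquad t>0, \] started at rest (that is, $u$ is continuously differentiable on $[0,\infty)$ with $\dot u(0)=0$), such that $F(u(t))\geq g(t)$ for all $t\geq 1$. -/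

import Mathlib

open Set MeasureTheory

/-- `u : [0, ∞) → H` is a solution, started at rest, of the heavy-ball ODE
`ü = -(α / t) u̇ - ∇F(u)` on `(0, ∞)`: `u` is `C¹` on `[0, ∞)` with velocity `u̇ = v`,
`v 0 = 0`, and the equation holds (with `v` differentiable) at every `t > 0`.
The values of `u` at negative times play no role. -/
def IsHeavyBallSolution {H : Type*} [NormedAddCommGroup H] [InnerProductSpace ℝ H]
    [CompleteSpace H] (α : ℝ) (F : H → ℝ) (u : ℝ → H) : Prop :=
  ∃ v : ℝ → H,
    v 0 = 0 ∧
    ContinuousOn v (Ici 0) ∧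
    (∀ t : ℝ, 0 ≤ t → HasDerivWithinAt u (v t) (Ici 0) t) ∧
    (∀ t : ℝ, 0 < t → HasDerivAt v (-(α / t) • v t - gradient F (u t)) t)

/-! Take `F x = ⟪A x, x⟫ / 2` with `A` diagonal in a Hilbert basis and eigenvalues `l n = 4⁻ⁿ / 16`.
The ODE decouples: mode `n` is its initial value times `p (l n * t ^ 2)`, with `p` an entire
Bessel-type function. Since `p ≥ 1/2` on `[0, 1/4]` for every `α > 0` (`half_le_tsum_besselCoeff`),
mode `n` keeps at least half its amplitude until time `2 ^ (n + 1)`. Only the initial point depends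
on `g`: its squared coefficients are multiples of `4 ^ n * g (2 ^ n)`, summable by dyadic
condensation of `∫ t g`. For `2 ^ n ≤ t < 2 ^ (n + 1)`, mode `n` alone then contributes energy at
least `g (2 ^ n) ≥ g t`. The flow is a power series in `t ^ 2` with coefficients in `H`, so
regularity and the ODE are checked in `H` and not mode by mode. -/

open scoped InnerProductSpace Nat

section PowerSeries

variable {E : Type*} [NormedAddCommGroup E] [NormedSpace ℝ E]

/-- Coefficients of a vector-valued entire power series of exponential type. -/
def FactorialDecay (w : ℕ → E) : Prop :=
  ∃ M R : ℝ, 0 ≤ M ∧ 0 ≤ R ∧ ∀ k, ‖w k‖ ≤ M * (R ^ k / k !)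

theorem FactorialDecay.norm_summable {w : ℕ → E} (hw : FactorialDecay w) (s : ℝ) :
    Summable fun k => ‖s ^ k • w k‖ := by
  obtain ⟨M, R, hM, hR, h⟩ := hw
  refine Summable.of_nonneg_of_le (fun _ => norm_nonneg _) (fun k => ?_)
    ((Real.summable_pow_div_factorial (|s| * R)).mul_left M)
  rw [norm_smul, norm_pow, Real.norm_eq_abs, mul_pow]
  calc |s| ^ k * ‖w k‖ ≤ |s| ^ k * (M * (R ^ k / k !)) := by gcongr; exact h k
    _ = M * (|s| ^ k * R ^ k / k !) := by ring

theorem FactorialDecay.derivCoeff {w : ℕ → E} (hw : FactorialDecay w) :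
    FactorialDecay fun k => ((k : ℝ) + 1) • w (k + 1) := by
  obtain ⟨M, R, hM, hR, h⟩ := hw
  refine ⟨M * R, R, by positivity, hR, fun k => ?_⟩
  rw [norm_smul, Real.norm_of_nonneg (by positivity)]
  calc ((k : ℝ) + 1) * ‖w (k + 1)‖
      ≤ ((k : ℝ) + 1) * (M * (R ^ (k + 1) / (k + 1)!)) := by gcongr; exact h _
    _ = M * R * (R ^ k / k !) := by
      rw [Nat.factorial_succ]
      push_cast
      field_simp
      ring

variable [CompleteSpace E]

theorem FactorialDecay.summable {w : ℕ → E} (hw : FactorialDecay w) (s : ℝ) :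
    Summable fun k => s ^ k • w k :=
  (hw.norm_summable s).of_norm

theorem FactorialDecay.hasDerivAt {w : ℕ → E} (hw : FactorialDecay w) (s : ℝ) :
    HasDerivAt (fun s : ℝ => ∑' k, s ^ k • w k)
      (∑' k : ℕ, s ^ k • ((k : ℝ) + 1) • w (k + 1)) s := by
  set r : ℝ := |s| + 1
  have hr : 0 ≤ r := by positivity
  have hs : s ∈ Metric.ball (0 : ℝ) r := by simp [r]
  have hsum : Summable fun k : ℕ => ‖((k : ℝ) * r ^ (k - 1)) • w k‖ := by
    rw [← summable_nat_add_iff 1]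
    refine (hw.derivCoeff.norm_summable r).congr fun k => ?_
    simp only [smul_smul, Nat.add_sub_cancel]
    push_cast
    rw [mul_comm]
  have key : HasDerivAt (fun s : ℝ => ∑' k, s ^ k • w k)
      (∑' k : ℕ, ((k : ℝ) * s ^ (k - 1)) • w k) s := by
    refine hasDerivAt_tsum_of_isPreconnected hsum Metric.isOpen_ball
      (convex_ball (0 : ℝ) r).isPreconnected (fun k y _ => (hasDerivAt_pow k y).smul_const (w k))
      (fun k y hy => ?_) hs (hw.summable s) hs
    have hy' : |y| ≤ r := by simpa using (mem_ball_zero_iff.1 hy).le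
    rw [norm_smul, norm_smul, norm_mul, norm_mul, norm_pow, norm_pow]
    gcongr
    simpa [abs_of_nonneg hr] using hy'
  convert key using 1
  have hsum' : Summable fun k : ℕ => ((k : ℝ) * s ^ (k - 1)) • w k := by
    rw [← summable_nat_add_iff 1]
    refine (hw.derivCoeff.summable s).congr fun k => ?_
    simp only [smul_smul, Nat.add_sub_cancel]
    push_cast
    rw [mul_comm]
  rw [hsum'.tsum_eq_zero_add]
  simp only [Nat.cast_zero, zero_mul, zero_smul, zero_add, Nat.add_sub_cancel]
  refine tsum_congr fun k => ?_
  rw [smul_smul]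
  push_cast
  rw [mul_comm]

end PowerSeries

/-! ### The scalar profile. -/

section Bessel

/-- Coefficients of the entire function `p` for which `t ↦ p (t ^ 2)` solves
`y'' + (α / t) y' + y = 0` with `y 0 = 1`. -/
noncomputable def besselCoeff (α : ℝ) : ℕ → ℝ
  | 0 => 1
  | k + 1 => -besselCoeff α k / (2 * ((k : ℝ) + 1) * (2 * k + 1 + α))

theorem besselCoeff_succ_mul {α : ℝ} (hα : 0 < α) (k : ℕ) :
    2 * ((k : ℝ) + 1) * (2 * k + 1 + α) * besselCoeff α (k + 1) = -besselCoeff α k := by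
  rw [besselCoeff]
  field_simp

/-- As `2 * k + 1 + α ≥ 1`, each step of the recursion gains at least a factor `2 * (k + 1)`,
uniformly in `α`. -/
theorem abs_besselCoeff_le {α : ℝ} (hα : 0 < α) (k : ℕ) :
    |besselCoeff α k| ≤ (1 / 2) ^ k / k ! := by
  induction k with
  | zero => simp [besselCoeff]
  | succ k ih =>
    have h1 : (1 : ℝ) ≤ 2 * k + 1 + α := by
      have : (0 : ℝ) ≤ k := k.cast_nonneg
      linarith
    rw [besselCoeff, abs_div, abs_neg, abs_of_nonneg (by positivity :
      (0 : ℝ) ≤ 2 * ((k : ℝ) + 1) * (2 * k + 1 + α)), div_le_iff₀ (by positivity)]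
    calc |besselCoeff α k| ≤ (1 / 2) ^ k / k ! := ih
      _ = (1 / 2) ^ (k + 1) / (k + 1)! * (2 * ((k : ℝ) + 1) * 1) := by
        rw [Nat.factorial_succ]
        push_cast
        field_simp
        ring
      _ ≤ _ := by gcongr

theorem half_le_tsum_besselCoeff {α : ℝ} (hα : 0 < α) {z : ℝ} (hz0 : 0 ≤ z) (hz : z ≤ 1 / 4) :
    1 / 2 ≤ ∑' k, z ^ k * besselCoeff α k := by
  have hb (k : ℕ) : ‖z ^ k * besselCoeff α k‖ ≤ (1 / 8) ^ k := by
    rw [norm_mul, norm_pow, Real.norm_of_nonneg hz0]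
    calc z ^ k * |besselCoeff α k| ≤ (1 / 4) ^ k * (1 / 2) ^ k := by
          gcongr
          refine (abs_besselCoeff_le hα k).trans (div_le_self (by positivity) ?_)
          exact_mod_cast k.factorial_pos
      _ = (1 / 8) ^ k := by rw [← mul_pow]; norm_num
  have hgeo := hasSum_geometric_of_lt_one (r := (1 / 8 : ℝ)) (by norm_num) (by norm_num)
  have hs : Summable fun k => z ^ k * besselCoeff α k := .of_norm_bounded hgeo.summable hb
  -- The tail after the leading `1` is at most `1/7`, which leaves room above `1/2`.
  have hb' : ‖∑' k, z ^ (k + 1) * besselCoeff α (k + 1)‖ ≤ 1 / 8 * (1 - 1 / 8)⁻¹ := by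
    refine tsum_of_norm_bounded (hgeo.mul_left (1 / 8)) fun k => (hb (k + 1)).trans_eq ?_
    ring
  rw [hs.tsum_eq_zero_add]
  have := (abs_le.1 hb').1
  norm_num [besselCoeff] at this ⊢
  linarith

end Bessel

/-! ### The vector-valued flow. -/

section HeavyBall

variable {H : Type*} [NormedAddCommGroup H] [InnerProductSpace ℝ H]

/-- Power series coefficients, in the variable `t ^ 2`, of the solution starting at `x` of
`u'' + (α / t) u' + A u = 0`. -/
noncomputable def heavyBallCoeff (α : ℝ) (A : H →L[ℝ] H) (x : H) (k : ℕ) : H :=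
  besselCoeff α k • (A ^ k) x

/-- The solution starting at rest at `x` of `u'' + (α / t) u' + A u = 0`. -/
noncomputable def heavyBallFlow (α : ℝ) (A : H →L[ℝ] H) (x : H) (t : ℝ) : H :=
  ∑' k, (t ^ 2) ^ k • heavyBallCoeff α A x k

theorem factorialDecay_heavyBallCoeff {α : ℝ} (hα : 0 < α) (A : H →L[ℝ] H) (x : H) :
    FactorialDecay (heavyBallCoeff α A x) := by
  refine ⟨‖x‖, 1 / 2 * ‖A‖, by positivity, by positivity, fun k => ?_⟩
  have hA : ‖(A ^ k) x‖ ≤ ‖A‖ ^ k * ‖x‖ := by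
    induction k with
    | zero => simp
    | succ k ih =>
      rw [pow_succ', mul_apply_eq_comp]
      calc ‖A ((A ^ k) x)‖ ≤ ‖A‖ * ‖(A ^ k) x‖ := A.le_opNorm _
        _ ≤ ‖A‖ * (‖A‖ ^ k * ‖x‖) := by gcongr
        _ = ‖A‖ ^ (k + 1) * ‖x‖ := by ring
  rw [heavyBallCoeff, norm_smul, Real.norm_eq_abs]
  calc |besselCoeff α k| * ‖(A ^ k) x‖ ≤ (1 / 2) ^ k / k ! * (‖A‖ ^ k * ‖x‖) := by
        gcongr
        exact abs_besselCoeff_le hα k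
    _ = _ := by rw [mul_pow]; ring

theorem heavyBallCoeff_succ {α : ℝ} (hα : 0 < α) (A : H →L[ℝ] H) (x : H) (k : ℕ) :
    (2 * ((k : ℝ) + 1) * (2 * k + 1 + α)) • heavyBallCoeff α A x (k + 1) =
      -A (heavyBallCoeff α A x k) := by
  rw [heavyBallCoeff, smul_smul, besselCoeff_succ_mul hα, heavyBallCoeff, map_smul, pow_succ',
    mul_apply_eq_comp, neg_smul]

variable [CompleteSpace H]

/-- In the variable `s = t ^ 2` the equation reads `4 s P'' + 2 (1 + α) P' = -A P`. -/
theorem heavyBallCoeff_series_eq {α : ℝ} (hα : 0 < α) (A : H →L[ℝ] H) (x : H) (s : ℝ) :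
    (4 * s) • (∑' k : ℕ, s ^ k • ((k : ℝ) + 1) • (((k + 1 : ℕ) : ℝ) + 1) •
      heavyBallCoeff α A x (k + 1 + 1)) +
    (2 * (1 + α)) • (∑' k : ℕ, s ^ k • ((k : ℝ) + 1) • heavyBallCoeff α A x (k + 1)) =
      -A (∑' k, s ^ k • heavyBallCoeff α A x k) := by
  have h0 := factorialDecay_heavyBallCoeff hα A x
  have hrec := heavyBallCoeff_succ hα A x
  generalize heavyBallCoeff α A x = w at h0 hrec ⊢
  have s0 := (A.hasSum (h0.summable s).hasSum).neg
  have s1 := (h0.derivCoeff.summable s).hasSum.const_smul (2 * (1 + α))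
  have s2 := (h0.derivCoeff.derivCoeff.summable s).hasSum.const_smul (4 * s)
  -- The factor `s` shifts the index by one; the new `k = 0` term vanishes through its factor `k`.
  have s2' : HasSum (fun k : ℕ => (s ^ k * (4 * (k : ℝ) * ((k : ℝ) + 1))) • w (k + 1))
      ((4 * s) • ∑' k : ℕ, s ^ k • ((k : ℝ) + 1) • (((k + 1 : ℕ) : ℝ) + 1) • w (k + 1 + 1)) := by
    rw [← hasSum_nat_add_iff' 1]
    simp only [Finset.sum_range_one, Nat.cast_zero, mul_zero, zero_mul, zero_smul, sub_zero]
    refine s2.congr_fun fun k => ?_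
    rw [smul_smul, smul_smul, smul_smul]
    congr 1
    push_cast
    ring
  refine (s2'.add s1).unique (s0.congr_fun fun k => ?_)
  rw [map_smul, ← smul_neg, ← hrec, smul_smul, smul_smul, smul_smul, ← add_smul]
  congr 1
  ring

theorem isHeavyBallSolution_heavyBallFlow {α : ℝ} (hα : 0 < α) (A : H →L[ℝ] H) (x : H)
    {F : H → ℝ} (hF : ∀ y, gradient F y = A y) :
    IsHeavyBallSolution α F (heavyBallFlow α A x) := by
  have h0 := factorialDecay_heavyBallCoeff hα A x
  obtain ⟨P, hP⟩ : ∃ P : ℝ → H, P = fun s => ∑' k, s ^ k • heavyBallCoeff α A x k := ⟨_, rfl⟩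
  obtain ⟨P1, hP1⟩ : ∃ P1 : ℝ → H, P1 = fun s =>
    ∑' k : ℕ, s ^ k • ((k : ℝ) + 1) • heavyBallCoeff α A x (k + 1) := ⟨_, rfl⟩
  obtain ⟨P2, hP2⟩ : ∃ P2 : ℝ → H, P2 = fun s =>
    ∑' k : ℕ, s ^ k • ((k : ℝ) + 1) • (((k + 1 : ℕ) : ℝ) + 1) •
      heavyBallCoeff α A x (k + 1 + 1) := ⟨_, rfl⟩
  have dP (s : ℝ) : HasDerivAt P (P1 s) s := by
    rw [hP, hP1]
    exact h0.hasDerivAt s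
  have dP1 (s : ℝ) : HasDerivAt P1 (P2 s) s := by
    rw [hP1, hP2]
    exact h0.derivCoeff.hasDerivAt s
  have hode (s : ℝ) : (4 * s) • P2 s + (2 * (1 + α)) • P1 s = -A (P s) := by
    rw [hP, hP1, hP2]
    exact heavyBallCoeff_series_eq hα A x s
  have hu : heavyBallFlow α A x = fun t => P (t ^ 2) := by
    rw [hP]
    rfl
  have dsq (t : ℝ) : HasDerivAt (fun t : ℝ => t ^ 2) (2 * t) t := by
    simpa using hasDerivAt_pow 2 t
  have du (t : ℝ) : HasDerivAt (fun t => P (t ^ 2)) ((2 * t) • P1 (t ^ 2)) t :=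
    HasDerivAt.scomp (g₁ := P) (h := fun t : ℝ => t ^ 2) t (dP (t ^ 2)) (dsq t)
  have dv (t : ℝ) : HasDerivAt (fun t : ℝ => (2 * t) • P1 (t ^ 2))
      ((2 * t) • (2 * t) • P2 (t ^ 2) + (2 : ℝ) • P1 (t ^ 2)) t := by
    have h1 : HasDerivAt (fun t => P1 (t ^ 2)) ((2 * t) • P2 (t ^ 2)) t :=
      HasDerivAt.scomp (g₁ := P1) (h := fun t : ℝ => t ^ 2) t (dP1 (t ^ 2)) (dsq t)
    have h2 : HasDerivAt (fun t : ℝ => 2 * t) 2 t := by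
      simpa using (hasDerivAt_id t).const_mul 2
    exact h2.smul h1
  rw [hu]
  refine ⟨fun t => (2 * t) • P1 (t ^ 2), by simp,
    (continuous_iff_continuousAt.2 fun t => (dv t).continuousAt).continuousOn,
    fun t _ => (du t).hasDerivWithinAt, fun t ht => ?_⟩
  convert dv t using 1
  -- The singularity `α / t` cancels against the factor `t` in the velocity.
  have hfriction : -(α / t) • (2 * t) • P1 (t ^ 2) = (-(2 * α)) • P1 (t ^ 2) := by
    rw [smul_smul]
    congr 1
    field_simp
  rw [hF, sub_eq_add_neg, ← hode (t ^ 2), hfriction]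
  module

theorem inner_heavyBallFlow {α : ℝ} (hα : 0 < α) {A : H →L[ℝ] H}
    (hA : ∀ x y, ⟪A x, y⟫_ℝ = ⟪x, A y⟫_ℝ) {e : H} {l : ℝ} (he : A e = l • e) (x : H) (t : ℝ) :
    ⟪e, heavyBallFlow α A x t⟫_ℝ = (∑' k, (l * t ^ 2) ^ k * besselCoeff α k) * ⟪e, x⟫_ℝ := by
  have hpow (k : ℕ) : ⟪e, (A ^ k) x⟫_ℝ = l ^ k * ⟪e, x⟫_ℝ := by
    induction k with
    | zero => simp
    | succ k ih =>
      rw [pow_succ', mul_apply_eq_comp, ← hA, he, real_inner_smul_left, ih]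
      ring
  have hs := (factorialDecay_heavyBallCoeff hα A x).summable (t ^ 2)
  change innerSL ℝ e (∑' k, (t ^ 2) ^ k • heavyBallCoeff α A x k) = _
  rw [(innerSL ℝ e).map_tsum hs, ← tsum_mul_right]
  refine tsum_congr fun k => ?_
  simp only [heavyBallCoeff, innerSL_apply_apply, real_inner_smul_right, hpow, mul_pow]
  ring

end HeavyBall

/-! ### Countable Hilbert basis and diagonal operator. -/

section Diagonal

variable {H : Type*} [NormedAddCommGroup H] [InnerProductSpace ℝ H] [CompleteSpace H]

theorem exists_hilbertBasis_nat [TopologicalSpace.SeparableSpace H]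
    (hH : ¬ FiniteDimensional ℝ H) : Nonempty (HilbertBasis ℕ ℝ H) := by
  obtain ⟨s, b, -⟩ := exists_hilbertBasis ℝ H
  have hcount : Countable s := by
    refine Pairwise.countable_of_isOpen_disjoint (s := fun i => Metric.ball (b i) (1 / 2))
      (fun i j hij => ?_) (fun _ => Metric.isOpen_ball)
      (fun i => ⟨b i, Metric.mem_ball_self (by norm_num)⟩)
    refine Metric.ball_disjoint_ball ?_
    rw [dist_eq_norm]
    -- Basis vectors are `√2 > 1` apart, so balls of radius `1/2` are disjoint and separability
    -- makes the basis countable.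
    have h : ‖b i - b j‖ ^ 2 = 2 := by
      rw [norm_sub_sq_real, b.orthonormal.1, b.orthonormal.1, b.orthonormal.2 hij]
      norm_num
    nlinarith [norm_nonneg (b i - b j)]
  have hinf : Infinite s := by
    by_contra hfin
    rw [not_infinite_iff_finite] at hfin
    have := Fintype.ofFinite s
    exact hH b.toOrthonormalBasis.toBasis.finiteDimensional_of_finite
  obtain ⟨e⟩ := nonempty_equiv_of_countable (α := ℕ) (β := s)
  refine ⟨HilbertBasis.mk (b.orthonormal.comp e e.injective) ?_⟩
  rw [e.surjective.range_comp, b.dense_span]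

/-- Summability of `l` makes the series of rank-one projections converge absolutely in operator
norm. -/
theorem exists_diagonal_operator (b : HilbertBasis ℕ ℝ H) {l : ℕ → ℝ} (hl : Summable l)
    (hl0 : ∀ n, 0 ≤ l n) :
    ∃ A : H →L[ℝ] H, ∀ x y, HasSum (fun n => l n * ⟪b n, x⟫_ℝ * ⟪b n, y⟫_ℝ) ⟪A x, y⟫_ℝ := by
  have hs : Summable fun n => l n • InnerProductSpace.rankOne ℝ (b n) (b n) := by
    refine .of_norm_bounded hl fun n => ?_
    rw [norm_smul, InnerProductSpace.norm_rankOne, b.orthonormal.1, Real.norm_of_nonneg (hl0 n)]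
    simp
  refine ⟨∑' n, l n • InnerProductSpace.rankOne ℝ (b n) (b n), fun x y => ?_⟩
  have h := (innerSL ℝ y).hasSum ((ContinuousLinearMap.apply ℝ H x).hasSum hs.hasSum)
  rw [real_inner_comm]
  refine h.congr_fun fun n => ?_
  simp [real_inner_comm, mul_assoc]

end Diagonal

/-! ### Dyadic condensation. -/

theorem summable_four_pow_mul_of_integrableOn {g : ℝ → ℝ} (hg : AntitoneOn g (Ioi 0))
    (hpos : ∀ t : ℝ, 0 < t → 0 < g t)
    (hint : IntegrableOn (fun t : ℝ => t * g t) (Ioi 0) volume) :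
    Summable fun n : ℕ => (4 : ℝ) ^ n * g (2 ^ n) := by
  have hii {a b : ℝ} (ha : 0 < a) (hab : a ≤ b) :
      IntervalIntegrable (fun t => t * g t) volume a b := by
    rw [intervalIntegrable_iff_integrableOn_Ioc_of_le hab]
    exact hint.mono_set fun t ht => ha.trans ht.1
  -- On `[2 ^ n / 2, 2 ^ n]`, of length `2 ^ n / 2`, the integrand is at least `2 ^ n / 2 * g (2 ^
  -- n)`.
  have hstep (n : ℕ) : (4 : ℝ) ^ n * g (2 ^ n) / 4 ≤
      ∫ t in (2 : ℝ) ^ n / 2..(2 : ℝ) ^ (n + 1) / 2, t * g t := by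
    have hle : (2 : ℝ) ^ n / 2 ≤ 2 ^ (n + 1) / 2 := by gcongr <;> norm_num
    have hp : (0 : ℝ) < 2 ^ n := by positivity
    have hc : (4 : ℝ) ^ n * g (2 ^ n) / 4 =
        ∫ _ in (2 : ℝ) ^ n / 2..(2 : ℝ) ^ (n + 1) / 2, (2 : ℝ) ^ n / 2 * g (2 ^ n) := by
      rw [intervalIntegral.integral_const, smul_eq_mul, pow_succ,
        show (4 : ℝ) ^ n = 2 ^ n * 2 ^ n by rw [← mul_pow]; norm_num]
      ring
    rw [hc]
    refine intervalIntegral.integral_mono_on hle (by simp) (hii (by positivity) hle) fun t ht => ?_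
    have ht0 : 0 < t := lt_of_lt_of_le (by positivity) ht.1
    have ht2 : t ≤ 2 ^ n := by
      have := ht.2
      rw [pow_succ] at this
      linarith
    have := hpos _ hp
    exact mul_le_mul ht.1 (hg ht0 hp ht2) this.le ht0.le
  refine summable_of_sum_range_le (c := 4 * ∫ t in Ioi 0, t * g t)
    (fun n => mul_nonneg (by positivity) (hpos _ (by positivity)).le) fun N => ?_
  have hsum : ∑ n ∈ Finset.range N, (4 : ℝ) ^ n * g (2 ^ n) / 4 ≤
      ∫ t in (2 : ℝ) ^ 0 / 2..(2 : ℝ) ^ N / 2, t * g t := by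
    rw [← intervalIntegral.sum_integral_adjacent_intervals (a := fun n : ℕ => (2 : ℝ) ^ n / 2)
      fun n _ => hii (by positivity) (by gcongr <;> norm_num)]
    exact Finset.sum_le_sum fun n _ => hstep n
  have hmono : ∫ t in (2 : ℝ) ^ 0 / 2..(2 : ℝ) ^ N / 2, t * g t ≤ ∫ t in Ioi 0, t * g t := by
    rw [intervalIntegral.integral_of_le (by gcongr <;> norm_num)]
    refine setIntegral_mono_set hint ?_ ?_
    · filter_upwards [ae_restrict_mem measurableSet_Ioi] with t ht
      exact mul_nonneg (le_of_lt ht) (hpos t ht).le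
    · refine Filter.Eventually.of_forall fun t ht => ?_
      exact lt_trans (by norm_num) ht.1
  rw [← Finset.sum_div] at hsum
  linarith

/-! ### The quadratic form. -/

section Energy

variable {H : Type*} [NormedAddCommGroup H] [InnerProductSpace ℝ H]

/-- The quadratic form `x ↦ ⟪A x, x⟫ / 2`. -/
noncomputable def halfInnerForm (A : H →L[ℝ] H) : QuadraticForm ℝ H :=
  LinearMap.BilinMap.toQuadraticMap ((1 / 2 : ℝ) • (innerₗ H).comp (A : H →ₗ[ℝ] H))

theorem halfInnerForm_apply (A : H →L[ℝ] H) (x : H) :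
    halfInnerForm A x = 1 / 2 * ⟪A x, x⟫_ℝ := by
  simp [halfInnerForm]

theorem strictConvexOn_halfInnerForm {A : H →L[ℝ] H}
    (hpos : ∀ x, x ≠ 0 → 0 < ⟪A x, x⟫_ℝ) :
    StrictConvexOn ℝ univ (halfInnerForm A) := by
  refine ⟨convex_univ, fun x _ y _ hxy a b ha hb hab => ?_⟩
  have h := hpos (x - y) (sub_ne_zero.2 hxy)
  obtain rfl : b = 1 - a := by linarith
  -- The convexity gap is exactly half of `a * b * ⟪A (x - y), x - y⟫`.
  have key := mul_pos (mul_pos ha hb) h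
  simp only [halfInnerForm_apply, map_add, map_sub, map_smul, inner_add_left, inner_add_right,
    inner_sub_left, inner_sub_right, real_inner_smul_left, real_inner_smul_right,
    smul_eq_mul] at key ⊢
  nlinarith

variable [CompleteSpace H]

theorem hasGradientAt_halfInnerForm {A : H →L[ℝ] H} (hA : ∀ x y, ⟪A x, y⟫_ℝ = ⟪x, A y⟫_ℝ)
    (x : H) : HasGradientAt (halfInnerForm A) (A x) x := by
  rw [hasGradientAt_iff_hasFDerivAt]
  have h := ((A.hasFDerivAt (x := x)).inner ℝ (hasFDerivAt_id x)).const_mul (1 / 2 : ℝ)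
  have hfun : ⇑(halfInnerForm A) = fun y => 1 / 2 * ⟪A y, id y⟫_ℝ :=
    funext fun y => halfInnerForm_apply A y
  rw [hfun]
  refine h.congr_fderiv ?_
  ext y
  have : ⟪A y, x⟫_ℝ = ⟪A x, y⟫_ℝ := by rw [hA, real_inner_comm]
  simp [this]
  ring

end Energy

theorem mainTheorem10 {H : Type*} [NormedAddCommGroup H] [InnerProductSpace ℝ H]
    [CompleteSpace H] [TopologicalSpace.SeparableSpace H] (hH : ¬ FiniteDimensional ℝ H) :
    ∃ F : QuadraticForm ℝ H,
      Continuous F ∧ Differentiable ℝ F ∧ StrictConvexOn ℝ univ F ∧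
      (∀ u : H, 0 ≤ F u) ∧ (∀ u : H, F u = 0 ↔ u = 0) ∧
      ∀ α : ℝ, 0 < α →
      ∀ g : ℝ → ℝ, AntitoneOn g (Ioi 0) → (∀ t : ℝ, 0 < t → 0 < g t) →
        IntegrableOn (fun t : ℝ => t * g t) (Ioi 0) volume →
        ∃ u : ℝ → H, IsHeavyBallSolution α F u ∧ ∀ t : ℝ, 1 ≤ t → g t ≤ F (u t) := by
  obtain ⟨b⟩ := exists_hilbertBasis_nat hH
  -- The `1/16` gives `l n * (2 ^ (n + 1)) ^ 2 = 1/4`, the end of the range where `p ≥ 1/2`.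
  set l : ℕ → ℝ := fun n => 1 / 16 * (1 / 4) ^ n with hl
  have hlpos (n : ℕ) : 0 < l n := by positivity
  have hlsum : Summable l :=
    (summable_geometric_of_lt_one (by norm_num) (by norm_num)).mul_left _
  obtain ⟨A, hA⟩ := exists_diagonal_operator b hlsum fun n => (hlpos n).le
  have hsymm (x y : H) : ⟪A x, y⟫_ℝ = ⟪x, A y⟫_ℝ := by
    rw [real_inner_comm (A y) x]
    exact (hA x y).unique ((hA y x).congr_fun fun n => by ring)
  have heig (n : ℕ) : A (b n) = l n • b n := by
    refine ext_inner_right ℝ fun y => ?_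
    rw [real_inner_smul_left]
    refine (hA (b n) y).unique ?_
    convert hasSum_single n fun m hm => ?_ using 1
    · rw [real_inner_self_eq_norm_sq, b.orthonormal.1]
      ring
    · rw [b.orthonormal.2 hm]
      ring
  have hcoord (n : ℕ) (x : H) : l n * ⟪b n, x⟫_ℝ ^ 2 ≤ ⟪A x, x⟫_ℝ := by
    refine le_trans (by rw [pow_two, ← mul_assoc]) (le_hasSum (hA x x) n fun m _ => ?_)
    rw [mul_assoc]
    exact mul_nonneg (hlpos m).le (mul_self_nonneg _)
  have hpos (x : H) (hx : x ≠ 0) : 0 < ⟪A x, x⟫_ℝ := by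
    by_contra hle
    refine hx (b.repr.injective ?_)
    ext n
    rw [b.repr_apply_apply, map_zero]
    have h1 : ⟪b n, x⟫_ℝ ^ 2 ≤ 0 := by
      have := hcoord n x
      have := hlpos n
      by_contra! hc
      have := mul_pos (hlpos n) hc
      linarith
    simpa using le_antisymm h1 (sq_nonneg _)
  have hnonneg (x : H) : 0 ≤ ⟪A x, x⟫_ℝ := by
    obtain rfl | hx := eq_or_ne x 0
    · simp
    · exact (hpos x hx).le
  have hgrad := hasGradientAt_halfInnerForm hsymm
  have hdiff : Differentiable ℝ (halfInnerForm A) := fun x => (hgrad x).differentiableAt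
  refine ⟨halfInnerForm A, hdiff.continuous, hdiff, strictConvexOn_halfInnerForm hpos,
    fun x => ?_, fun x => ⟨fun hx => ?_, fun hx => by simp [hx]⟩, fun α hα g hg hg0 hint => ?_⟩
  · rw [halfInnerForm_apply]
    exact mul_nonneg (by norm_num) (hnonneg x)
  · by_contra hne
    have := hpos x hne
    rw [halfInnerForm_apply] at hx
    linarith
  -- `128` offsets the `1/2` in `F`, the `1/16` in `l n` and the bound `p ^ 2 ≥ 1/4`.
  · set a : ℕ → ℝ := fun n => √(128 * (4 ^ n * g (2 ^ n)))
    have hg2 (n : ℕ) : 0 < g (2 ^ n) := hg0 _ (by positivity)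
    have hasq (n : ℕ) : a n ^ 2 = 128 * (4 ^ n * g (2 ^ n)) :=
      Real.sq_sqrt (by have := hg2 n; positivity)
    have hmem : Memℓp a 2 := by
      refine memℓp_gen ?_
      simpa [hasq] using (summable_four_pow_mul_of_integrableOn hg hg0 hint).mul_left 128
    set x : H := b.repr.symm ⟨a, hmem⟩ with hx
    have hxc (n : ℕ) : ⟪b n, x⟫_ℝ = a n := by
      rw [← b.repr_apply_apply, hx, LinearIsometryEquiv.apply_symm_apply]
    refine ⟨heavyBallFlow α A x,
      isHeavyBallSolution_heavyBallFlow hα A x fun y => (hgrad y).gradient, fun t ht => ?_⟩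
    obtain ⟨n, hn1, hn2⟩ := exists_nat_pow_near ht (by norm_num : (1 : ℝ) < 2)
    have ht0 : 0 < t := by linarith
    have hp4 : (1 / 4 : ℝ) ^ n * 4 ^ n = 1 := by rw [← mul_pow]; norm_num
    have hz : l n * t ^ 2 ≤ 1 / 4 := by
      calc l n * t ^ 2 ≤ l n * (2 ^ (n + 1)) ^ 2 := by
            have := (hlpos n).le
            gcongr
        _ = 1 / 4 * ((1 / 4) ^ n * 4 ^ n) := by
          rw [hl, show (4 : ℝ) ^ n = 2 ^ n * 2 ^ n by rw [← mul_pow]; norm_num]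
          ring
        _ = 1 / 4 := by rw [hp4, mul_one]
    have hp := half_le_tsum_besselCoeff hα (mul_nonneg (hlpos n).le (sq_nonneg t)) hz
    have hc := hcoord n (heavyBallFlow α A x t)
    rw [inner_heavyBallFlow hα hsymm (heig n), hxc, mul_pow, hasq] at hc
    set p := ∑' k, (l n * t ^ 2) ^ k * besselCoeff α k
    have hp2 : 1 / 4 ≤ p ^ 2 := by nlinarith
    rw [halfInnerForm_apply]
    have hgt : g t ≤ g (2 ^ n) := hg (by simp : (2 : ℝ) ^ n ∈ Ioi 0) ht0 hn1
    have hval : l n * (p ^ 2 * (128 * (4 ^ n * g (2 ^ n)))) = 8 * p ^ 2 * g (2 ^ n) := by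
      calc _ = 8 * p ^ 2 * g (2 ^ n) * ((1 / 4) ^ n * 4 ^ n) := by rw [hl]; ring
        _ = _ := by rw [hp4, mul_one]
    rw [hval] at hc
    have := mul_le_mul_of_nonneg_right hp2 (hg2 n).le
    linarith
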